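/- **Conventions.** Let $M$ be a monoid and $A\subseteq M$ a finite generating set. The (right) Cayley digraph $\Gamma(M,A)$ has vertex set $M$ and an edge from $m$ to $ma$ for all $m\in M$, $a\in A$. For a digraph $D$, $d_D(x,y)\in\mathbb N\cup\{\infty\}$ is the length of a shortest directed path from $x$ to $y$ ($\infty$ if there is none), and such a shortest path is called a geodesic. A geodesic triangle consists of three (possibly coinciding) vertices and, for every two of them, a geodesic between them in one of the two directions. The digraph $D$ is hyperbolic if there is $\delta\ge 0$ such that in every geodesic triangle each side $P$, say from $x$ to $y$, satisfies the following, where $Q$ is the side between $x$ and the third vertex $z$ and $R$ is the side between $y$ and $z$: every vertex $p$ of $P$ has $d_D(q,p)\le\delta$ for some vertex $q$ of $Q$ or $d_D(p,r)\le\delta$ for some vertex $r$ of $R$. A finitely generated monoid is hyperbolic if its Cayley digraph with respect to some finite generating set is hyperbolic. A self-embedding of $D$ is an injective map $V(D)\to V(D)$ that maps edges to edges and non-edges to non-edges. A map $f\colon V(D)\to V(D)$ is elliptic if $f(F)=F$ for some nonempty finite set $F$ of vertices. For $\gamma\ge1$ and $c\ge0$, a map $f\colon V(D_1)\to V(D_2)$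 is a $(\gamma,c)$-quasi-isometric embedding if $$\tfrac1\gamma d_{D_1}(u,v)-c\le d_{D_2}(f(u),f(v))\le \gamma\, d_{D_1}(u,v)+c\qquad\text{for all }u,v\in V(D_1).$$ **Theorem.** Let $M$ be a right cancellative, finitely generated hyperbolic monoid, let $g\in M$ have infinite order (that is, $g^n\neq 1$ for all $n\ge1$), and let $A$ be any finite generating set of $M$. Put $D=\Gamma(M,A)$, let $\lambda_g\colon M\to M$, $x\mapsto gx$, and let $\langle g\rangle=\{g^n: n\ge 0\}$ carry the distance $d_{\langle g\rangle}$ of its Cayley digraph with respect to $\{g\}$, so that $d_{\langle g\rangle}(g^m,g^n)$ is $n-m$ if $m\le n$ and $\infty$ otherwise. 1. The map $\lambda_g$ maps edges of $D$ to edges of $D$, and it is not elliptic. If $M$ is also left cancellative, then $\lambda_g$ is a self-embedding of $D$. 2. The embedding of $\langle g\rangle$ into $M$ is quasi-isometric in the following sense. There are $\gamma\ge1$ and $c\ge0$ such that for all $m\le n$ $$\tfrac1\gamma (n-m)-c\le d_D(g^m,g^n)\le\gamma(n-m)+c,$$ and for all $m<n$ either $d_D(g^n,g^m)=\infty$ or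 $$\tfrac1\gamma (n-m)-c\le d_D(g^n,g^m)\le\gamma(n-m)+c.$$ If moreover there are no $m<n$ and $x\in M$ with $g^nx=g^m$ (that is, if $d_D(g^n,g^m)=\infty$ for all $m<n$), then the embedding $\langle g\rangle\to M$ is a $(\gamma,c)$-quasi-isometric embedding of the Cayley digraph of $\langle g\rangle$ into $D$. This is the case in particular if $M$ is also left cancellative and $g$ is not invertible in $M$. -/

import Mathlib

open scoped NNReal ENNReal

namespace Digraph

variable {V : Type*} {W : Type*}

/-- A directed path `x₀, …, xₙ` in a digraph: consecutive vertices are joined by an edge.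
Only the values `vert i` with `i ≤ length` belong to the path. -/
structure DiPath (D : Digraph V) where
  length : ℕ
  vert : ℕ → V
  adj : ∀ i < length, D.Adj (vert i) (vert (i + 1))

namespace DiPath

variable {D : Digraph V}

/-- The first vertex of a directed path. -/
def first (P : D.DiPath) : V := P.vert 0

/-- The last vertex of a directed path. -/
def last (P : D.DiPath) : V := P.vert P.length

/-- The set of vertices of a directed path. -/
def support (P : D.DiPath) : Set V := {v | ∃ i ≤ P.length, P.vert i = v}

/-- `P` runs from `x` to `y`. -/
def IsFromTo (P : D.DiPath) (x y : V) : Prop := P.first = x ∧ P.last = y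

/-- `P` is a directed path between `x` and `y`, in one of the two directions. -/
def Joins (P : D.DiPath) (x y : V) : Prop := P.IsFromTo x y ∨ P.IsFromTo y x

end DiPath

/-- The distance from `x` to `y`: the length of a shortest directed path from `x` to `y`,
and `⊤` if there is none. -/
noncomputable def ddist (D : Digraph V) (x y : V) : ℕ∞ :=
  ⨅ (P : D.DiPath) (_ : P.IsFromTo x y), (P.length : ℕ∞)

/-- A geodesic is a shortest directed path between its end vertices. -/
def DiPath.IsGeodesic {D : Digraph V} (P : D.DiPath) : Prop :=
  (P.length : ℕ∞) = D.ddist P.first P.last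

/-- The out-ball of radius `r` around a vertex set. -/
def outBall (D : Digraph V) (r : ℝ≥0) (S : Set V) : Set V :=
  {y | ∃ x ∈ S, (D.ddist x y : ℝ≥0∞) ≤ r}

/-- The in-ball of radius `r` around a vertex set. -/
def inBall (D : Digraph V) (r : ℝ≥0) (S : Set V) : Set V :=
  {y | ∃ x ∈ S, (D.ddist y x : ℝ≥0∞) ≤ r}

/-- All geodesic triangles are `δ`-thin. The end vertices are `x, y, z`, and the sides are
geodesics `P, Q, R` between `x, y`, between `x, z` and between `y, z`, each in any direction.
As `x, y, z` range over all (possibly coinciding) vertices, naming the start of the side under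
consideration `x` and its end `y` covers all three sides of every triangle. -/
def IsDeltaHyperbolic (D : Digraph V) (δ : ℝ≥0) : Prop :=
  ∀ (x y z : V) (P Q R : D.DiPath), P.IsGeodesic → Q.IsGeodesic → R.IsGeodesic →
    P.IsFromTo x y → Q.Joins x z → R.Joins y z →
    P.support ⊆ D.outBall δ Q.support ∪ D.inBall δ R.support

/-- A digraph is hyperbolic if it is `δ`-hyperbolic for some `δ ≥ 0`. -/
def IsHyperbolic (D : Digraph V) : Prop := ∃ δ : ℝ≥0, D.IsDeltaHyperbolic δ

/-- A self-embedding: an injective map of the vertex set that maps edges to edges and non-edges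
to non-edges. -/
def IsSelfEmbedding (D : Digraph V) (f : V → V) : Prop :=
  Function.Injective f ∧ ∀ x y, D.Adj (f x) (f y) ↔ D.Adj x y

/-- A map of the vertex set is elliptic if it fixes a (nonempty) finite vertex set setwise. -/
def IsElliptic (f : V → V) : Prop := ∃ F : Set V, F.Finite ∧ F.Nonempty ∧ f '' F = F

/-- The inequalities `a / γ - c ≤ b ≤ γ * a + c` between distances with values in `ℕ ∪ {∞}`. -/
def QIBounds (γ c : ℝ≥0) (a b : ℕ∞) : Prop :=
  (a : ℝ≥0∞) / γ - c ≤ (b : ℝ≥0∞) ∧ (b : ℝ≥0∞) ≤ γ * (a : ℝ≥0∞) + c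

/-- A `(γ, c)`-quasi-isometric embedding of `D₁` into `D₂`. -/
def IsQIEmbedding (γ c : ℝ≥0) (D₁ : Digraph V) (D₂ : Digraph W) (f : V → W) : Prop :=
  1 ≤ γ ∧ ∀ u v, QIBounds γ c (D₁.ddist u v) (D₂.ddist (f u) (f v))

/-- The right Cayley digraph of a monoid with respect to a set `A`: edges from `m` to `m * a` for
`a ∈ A`. -/
def cayley {M : Type*} [Monoid M] (A : Set M) : Digraph M where
  Adj x y := ∃ a ∈ A, y = x * a

end Digraph

/-- `A` is a finite generating set of the monoid `M`. -/
def IsFiniteGeneratingSet {M : Type*} [Monoid M] (A : Set M) : Prop :=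
  A.Finite ∧ Submonoid.closure A = ⊤

/-- A finitely generated hyperbolic monoid: one that has a hyperbolic Cayley digraph with respect
to some finite generating set. -/
def IsHyperbolicMonoid (M : Type*) [Monoid M] : Prop :=
  ∃ A : Set M, IsFiniteGeneratingSet A ∧ (Digraph.cayley A).IsHyperbolic

/-- The Cayley digraph of the submonoid `⟨g⟩` generated by `g`, with respect to `{g}`. -/
def powersCayley {M : Type*} [Monoid M] (g : M) : Digraph (Submonoid.powers g) :=
  Digraph.cayley {⟨g, Submonoid.mem_powers g⟩}

/-! The weight lies on the forward lower bound, `IsThin.exists_le_mul_ddist_iterate`. Left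
multiplication f need not be an isometry, but d(f^B o, f^(B+n) o) is nonincreasing in B and
stabilises at some α(n). Here α is subadditive, and bounded out-balls force α(n) → ∞. Take N with
α(N) large and α(N) ≤ α(N+k) for all k, and a geodesic P from f^B o to f^(B+N) o with B large. The
images f^k P are again geodesics, and thinness makes f^k P follow P with a forward shift v_k, up to
an error R (`IsThin.ddist_le_of_square`). If v_k ≤ R for all 1 ≤ k ≤ K, too many distinct points f^k
p would lie in one in-ball, whose size right cancellation bounds. So some v_k exceeds R; iterating
f^k gains at least one step each time, whence α(mk) ≥ m and α(m) ≥ m/K.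

Directedness needs a second ingredient, `HasReturnBound`: a way back, if there is one, is at most κ
times as long as the way there. It makes geodesics fellow-travel, and it transfers the forward
bounds to finite backward distances. -/

namespace Digraph

variable {V : Type*} {D : Digraph V} {x y z : V}

/-! ### Directed distance and geodesics -/

section Distance

theorem ddist_le_length {P : D.DiPath} (h : P.IsFromTo x y) : D.ddist x y ≤ P.length :=
  iInf₂_le P h

theorem exists_isGeodesic (h : D.ddist x y ≠ ⊤) :
    ∃ P : D.DiPath, P.IsGeodesic ∧ P.IsFromTo x y ∧ D.ddist x y = P.length := by
  have hne : ∃ n : ℕ, ∃ P : D.DiPath, P.IsFromTo x y ∧ P.length = n := by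
    by_contra hcon
    push Not at hcon
    refine h (iInf₂_eq_top.2 fun P hP => absurd rfl (hcon _ P hP))
  classical
  obtain ⟨P, hP, hlen⟩ := Nat.find_spec hne
  have key : D.ddist x y = P.length := by
    refine le_antisymm (ddist_le_length hP) (le_iInf₂ fun Q hQ => ?_)
    rw [hlen]
    exact_mod_cast Nat.find_min' hne ⟨Q, hQ, rfl⟩
  refine ⟨P, ?_, hP, key⟩
  rw [DiPath.IsGeodesic, hP.1, hP.2, key]

theorem exists_isGeodesic_of_le {n : ℕ} (h : D.ddist x y ≤ n) :
    ∃ P : D.DiPath, P.IsGeodesic ∧ P.IsFromTo x y ∧ D.ddist x y = P.length ∧ P.length ≤ n := by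
  obtain ⟨P, hP, hxy, hl⟩ := exists_isGeodesic (ne_top_of_le_ne_top (ENat.natCast_ne_top n) h)
  exact ⟨P, hP, hxy, hl, by rw [hl] at h; exact_mod_cast h⟩

theorem DiPath.ddist_le (P : D.DiPath) {i j : ℕ} (hij : i ≤ j) (hj : j ≤ P.length) :
    D.ddist (P.vert i) (P.vert j) ≤ (j - i : ℕ) := by
  let Q : D.DiPath := ⟨j - i, fun k => P.vert (i + k), fun k hk => P.adj (i + k) (by omega)⟩
  refine ddist_le_length (P := Q) ⟨rfl, ?_⟩
  change P.vert (i + (j - i)) = _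
  rw [Nat.add_sub_cancel' hij]

theorem ddist_self (x : V) : D.ddist x x = 0 := by
  let Q : D.DiPath := ⟨0, fun _ => x, fun k hk => absurd hk (Nat.not_lt_zero k)⟩
  simpa [Q] using ddist_le_length (P := Q) (x := x) (y := x) ⟨rfl, rfl⟩

theorem Adj.ddist_le_one (h : D.Adj x y) : D.ddist x y ≤ (1 : ℕ) := by
  let Q : D.DiPath := ⟨1, fun k => if k = 0 then x else y, fun k hk => by
    obtain rfl : k = 0 := by omega
    simpa using h⟩
  exact ddist_le_length (P := Q) ⟨rfl, rfl⟩

theorem ddist_le_add {m n : ℕ} (h₁ : D.ddist x y ≤ m) (h₂ : D.ddist y z ≤ n) :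
    D.ddist x z ≤ (m + n : ℕ) := by
  obtain ⟨P, -, hP, -, hm⟩ := exists_isGeodesic_of_le h₁
  obtain ⟨Q, -, hQ, -, hn⟩ := exists_isGeodesic_of_le h₂
  let R : D.DiPath := ⟨P.length + Q.length,
    fun i => if i ≤ P.length then P.vert i else Q.vert (i - P.length), fun i hi => by
      have hPQ : P.vert P.length = Q.vert 0 := hP.2.trans hQ.1.symm
      rcases lt_trichotomy i P.length with h | rfl | h
      · simpa [h.le, Nat.succ_le_of_lt h] using P.adj i h
      · simpa [hPQ] using Q.adj 0 (by omega)
      · simpa [h.not_ge, show ¬ i + 1 ≤ P.length by omega,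
          show i + 1 - P.length = i - P.length + 1 by omega] using Q.adj (i - P.length) (by omega)⟩
  refine (ddist_le_length (P := R) (x := x) (y := z) ⟨?_, ?_⟩).trans ?_
  · simpa [R, DiPath.first] using hP.1
  · have hPQ : P.vert P.length = Q.vert 0 := hP.2.trans hQ.1.symm
    by_cases hq : Q.length = 0
    · simpa [R, DiPath.last, hq, hPQ] using hQ.2
    · simpa [R, DiPath.last, hq] using hQ.2
  · exact_mod_cast Nat.add_le_add hm hn

theorem ddist_triangle (x y z : V) : D.ddist x z ≤ D.ddist x y + D.ddist y z := by
  rcases eq_or_ne (D.ddist x y) ⊤ with h | h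
  · simp [h]
  rcases eq_or_ne (D.ddist y z) ⊤ with h' | h'
  · simp [h']
  lift D.ddist x y to ℕ using h with m hm
  lift D.ddist y z to ℕ using h' with n hn
  exact_mod_cast ddist_le_add hm.ge hn.ge

theorem ddist_ne_top_trans (h₁ : D.ddist x y ≠ ⊤) (h₂ : D.ddist y z ≠ ⊤) : D.ddist x z ≠ ⊤ :=
  ne_top_of_le_ne_top (by simp [h₁, h₂]) (ddist_triangle x y z)

theorem DiPath.IsGeodesic.ddist_eq {P : D.DiPath} (hP : P.IsGeodesic) {i j : ℕ} (hij : i ≤ j)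
    (hj : j ≤ P.length) : D.ddist (P.vert i) (P.vert j) = (j - i : ℕ) := by
  refine le_antisymm (P.ddist_le hij hj) ?_
  obtain ⟨n, hn⟩ := ENat.ne_top_iff_exists.1
    (ne_top_of_le_ne_top (ENat.natCast_ne_top _) (P.ddist_le hij hj))
  rw [← hn]
  have h := ddist_le_add (ddist_le_add (P.ddist_le (Nat.zero_le i) (hij.trans hj)) hn.ge)
    (P.ddist_le hj le_rfl)
  have h' : (P.length : ℕ∞) = D.ddist (P.vert 0) (P.vert P.length) := hP
  rw [← h'] at h
  norm_cast at h ⊢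
  omega

/-- Turns distance estimates into comparisons of positions on a geodesic; for `j < i` it is trivial,
which saves a case distinction at each use. -/
theorem DiPath.IsGeodesic.le_add {P : D.DiPath} (hP : P.IsGeodesic) {i j n : ℕ}
    (hj : j ≤ P.length) (h : D.ddist (P.vert i) (P.vert j) ≤ n) : j ≤ i + n := by
  by_cases hij : i ≤ j
  · rw [hP.ddist_eq hij hj] at h
    norm_cast at h
    omega
  · omega

/-- Thinness of geodesic triangles with respect to a natural number. -/
def IsThin (D : Digraph V) (δ : ℕ) : Prop :=
  ∀ (x y z : V) (P Q R : D.DiPath), P.IsGeodesic → Q.IsGeodesic → R.IsGeodesic →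
    P.IsFromTo x y → Q.Joins x z → R.Joins y z → ∀ i ≤ P.length,
      (∃ j ≤ Q.length, D.ddist (Q.vert j) (P.vert i) ≤ δ) ∨
      (∃ j ≤ R.length, D.ddist (P.vert i) (R.vert j) ≤ δ)

theorem IsDeltaHyperbolic.isThin {δ : ℝ≥0} (h : D.IsDeltaHyperbolic δ) : D.IsThin ⌈δ⌉₊ := by
  have cast_le : ∀ a : ℕ∞, (a : ℝ≥0∞) ≤ δ → a ≤ (⌈δ⌉₊ : ℕ) := by
    intro a ha
    have h1 : (a : ℝ≥0∞) ≤ ((⌈δ⌉₊ : ℕ) : ℕ∞) := by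
      refine ha.trans ?_
      rw [ENat.toENNReal_coe]
      exact_mod_cast ENNReal.coe_le_coe.2 (Nat.le_ceil δ)
    exact ENat.toENNReal_le.1 h1
  intro x y z P Q R hP hQ hR hxy hxz hyz i hi
  rcases h x y z P Q R hP hQ hR hxy hxz hyz ⟨i, hi, rfl⟩ with ⟨_, ⟨j, hj, rfl⟩, hd⟩ | ⟨_, ⟨j, hj, rfl⟩, hd⟩
  · exact Or.inl ⟨j, hj, cast_le _ hd⟩
  · exact Or.inr ⟨j, hj, cast_le _ hd⟩

end Distance

/-! ### Edge reversal -/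

section Reverse

/-- The digraph with all edges reversed. -/
def reverse (D : Digraph V) : Digraph V where
  Adj x y := D.Adj y x

/-- A directed path, traversed backwards in the reversed digraph. -/
def DiPath.reverse (P : D.DiPath) : D.reverse.DiPath where
  length := P.length
  vert i := P.vert (P.length - i)
  adj i hi := by
    have := P.adj (P.length - (i + 1)) (by omega)
    rwa [show P.length - (i + 1) + 1 = P.length - i by omega] at this

theorem DiPath.reverse_isFromTo {P : D.DiPath} :
    P.reverse.IsFromTo y x ↔ P.IsFromTo x y := by
  simp [IsFromTo, first, last, reverse, and_comm]

theorem DiPath.reverse_joins {P : D.DiPath} : P.reverse.Joins x y ↔ P.Joins x y := by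
  simp [Joins, reverse_isFromTo, or_comm]

theorem ddist_le_ddist_reverse (D : Digraph V) (x y : V) :
    D.ddist y x ≤ D.reverse.ddist x y :=
  le_iInf₂ fun P hP => ddist_le_length (P := DiPath.reverse (D := D.reverse) P)
    (DiPath.reverse_isFromTo.2 hP)

theorem ddist_reverse (D : Digraph V) (x y : V) : D.reverse.ddist x y = D.ddist y x :=
  le_antisymm (ddist_le_ddist_reverse D.reverse y x) (ddist_le_ddist_reverse D x y)

theorem DiPath.IsGeodesic.reverse {P : D.DiPath} (hP : P.IsGeodesic) : P.reverse.IsGeodesic := by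
  have h : (P.length : ℕ∞) = D.ddist P.first P.last := hP
  rw [IsGeodesic, ddist_reverse]
  simpa [DiPath.reverse, first, last] using h

/-- Reversal exchanges the two alternatives of thinness, hence also the roles of `Q` and `R`. -/
theorem IsThin.reverse {δ : ℕ} (h : D.IsThin δ) : D.reverse.IsThin δ := by
  intro x y z P Q R hP hQ hR hxy hxz hyz i hi
  have := h y x z (DiPath.reverse (D := D.reverse) P) (DiPath.reverse (D := D.reverse) R)
    (DiPath.reverse (D := D.reverse) Q) hP.reverse hR.reverse hQ.reverse
    (DiPath.reverse_isFromTo.2 hxy) (DiPath.reverse_joins.2 hyz) (DiPath.reverse_joins.2 hxz)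
    (P.length - i) (Nat.sub_le _ _)
  simp only [ddist_reverse]
  have hi' : (DiPath.reverse (D := D.reverse) P).vert (P.length - i) = P.vert i := by
    simp only [DiPath.reverse]
    rw [Nat.sub_sub_self hi]
  rw [hi'] at this
  rcases this with ⟨j, hj, hd⟩ | ⟨j, hj, hd⟩
  · exact Or.inr ⟨R.length - j, Nat.sub_le _ _, hd⟩
  · exact Or.inl ⟨Q.length - j, Nat.sub_le _ _, hd⟩

end Reverse

end Digraph

/-! ### Return bound and fellow-travelling geodesics -/

namespace Digraph

variable {V : Type*} {D : Digraph V} {x y z : V}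

/-- Out-balls are finite, with a bound on their sizes that depends only on the radius. -/
def HasBoundedOutBalls (D : Digraph V) : Prop :=
  ∀ r : ℕ, ∃ N : ℕ, ∀ (x : V) (s : Finset V), (∀ y ∈ s, D.ddist x y ≤ r) → s.card ≤ N

/-- The distance back from `v` to `u` is infinite or at most `κ` times that from `u` to `v`. -/
def HasReturnBound (D : Digraph V) (κ : ℕ) : Prop :=
  ∀ (u v : V) (n : ℕ), D.ddist v u ≠ ⊤ → D.ddist u v ≤ n → D.ddist v u ≤ (κ * n : ℕ)

theorem HasReturnBound.reverse {κ : ℕ} (h : D.HasReturnBound κ) : D.reverse.HasReturnBound κ := by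
  intro u v n hvu huv
  rw [ddist_reverse] at *
  exact h v u n hvu huv

/-- In the degenerate triangle formed by the edge, a geodesic back and a constant path at `u`, all
vertices of the geodesic except those near its ends lie in the out-ball of radius `δ` around `u`.
They are distinct, so there are at most `N`. -/
theorem IsThin.ddist_le_of_adj {δ N : ℕ} (h : D.IsThin δ)
    (hN : ∀ (x : V) (s : Finset V), (∀ y ∈ s, D.ddist x y ≤ δ) → s.card ≤ N)
    {u v : V} (huv : D.Adj u v) (hvu : D.ddist v u ≠ ⊤) :
    D.ddist v u ≤ (2 * δ + 1 + N : ℕ) := by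
  classical
  obtain ⟨P, hP, hPvu, hPl⟩ := exists_isGeodesic hvu
  obtain ⟨E, hE, hEuv, -, hEl⟩ := exists_isGeodesic_of_le huv.ddist_le_one
  obtain ⟨R, hR, hRu, -, hRl⟩ := exists_isGeodesic_of_le (D := D) (x := u) (n := 0)
    (ddist_self u).le
  have hmid : ∀ i, δ < i → i + δ < P.length → D.ddist u (P.vert i) ≤ δ := by
    intro i hi hi'
    rcases h v u u P E R hP hE hR hPvu (Or.inr hEuv) (Or.inl hRu) i (by omega) with
      ⟨j, hj, hd⟩ | ⟨j, hj, hd⟩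
    · rcases Nat.eq_zero_or_pos j with rfl | hj0
      · rwa [show E.vert 0 = u from hEuv.1] at hd
      · obtain rfl : j = E.length := by omega
        rw [show E.vert E.length = P.vert 0 from hEuv.2.trans hPvu.1.symm] at hd
        have := hP.le_add (by omega) hd
        omega
    · obtain rfl : j = 0 := by omega
      rw [show R.vert 0 = P.vert P.length from hRu.1.trans hPvu.2.symm] at hd
      have := hP.le_add le_rfl hd
      omega
  have hinj : Set.InjOn P.vert (Finset.Ioo δ (P.length - δ) : Finset ℕ) := by
    intro i hi j hj hij
    simp only [Finset.coe_Ioo, Set.mem_Ioo] at hi hj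
    have h1 := hP.le_add (i := i) (j := j) (n := 0) (by omega) (by rw [hij, ddist_self]; simp)
    have h2 := hP.le_add (i := j) (j := i) (n := 0) (by omega) (by rw [hij, ddist_self]; simp)
    omega
  have hcard := hN u ((Finset.Ioo δ (P.length - δ)).image P.vert) (by
    intro p hp
    obtain ⟨i, hi, rfl⟩ := Finset.mem_image.1 hp
    rw [Finset.mem_Ioo] at hi
    exact hmid i hi.1 (by omega))
  rw [Finset.card_image_of_injOn hinj, Nat.card_Ioo] at hcard
  rw [hPl]
  norm_cast
  omega

theorem IsThin.exists_hasReturnBound {δ : ℕ} (h : D.IsThin δ) (hD : D.HasBoundedOutBalls) :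
    ∃ κ, D.HasReturnBound κ := by
  obtain ⟨N, hN⟩ := hD δ
  refine ⟨2 * δ + 1 + N, fun u v n hvu huv => ?_⟩
  obtain ⟨P, hP, hPuv, -, hPn⟩ := exists_isGeodesic_of_le huv
  have hback : ∀ i ≤ P.length, D.ddist (P.vert i) u ≤ ((2 * δ + 1 + N) * i : ℕ) := by
    intro i
    induction i with
    | zero =>
      intro _
      rw [show P.vert 0 = u from hPuv.1, ddist_self]
      simp
    | succ i ih =>
      intro hi
      -- Each edge of the geodesic can be undone: go on to `v`, back to `u`, and along `P` again.
      have hne : D.ddist (P.vert (i + 1)) (P.vert i) ≠ ⊤ := by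
        have h1 := ne_top_of_le_ne_top (ENat.natCast_ne_top _) (P.ddist_le hi le_rfl)
        have h2 := ne_top_of_le_ne_top (ENat.natCast_ne_top _)
          (P.ddist_le (Nat.zero_le i) (by omega))
        rw [show P.vert P.length = v from hPuv.2] at h1
        rw [show P.vert 0 = u from hPuv.1] at h2
        exact ddist_ne_top_trans h1 (ddist_ne_top_trans hvu h2)
      have := ddist_le_add (h.ddist_le_of_adj hN (P.adj i (by omega)) hne) (ih (by omega))
      refine this.trans (le_of_eq ?_)
      congr 1
      ring
  have := hback P.length le_rfl
  rw [show P.vert P.length = v from hPuv.2] at this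
  refine this.trans ?_
  exact_mod_cast Nat.mul_le_mul_left _ hPn

/-- Two geodesics with a common start whose ends are joined by a geodesic of length `r` run close
to each other, up to a distance from their ends that depends on `r`. -/
theorem IsThin.ddist_le_of_common_start {δ κ : ℕ} (h : D.IsThin δ) (hκ : D.HasReturnBound κ)
    {P S R : D.DiPath} (hP : P.IsGeodesic) (hS : S.IsGeodesic) (hR : R.IsGeodesic)
    (hxy : P.IsFromTo x y) (hxz : S.IsFromTo x z) (hyz : R.IsFromTo y z)
    (hle : P.length ≤ S.length) {t : ℕ}
    (ht : t + (3 * δ + R.length + 2 + κ * (3 * δ + R.length + 1)) ≤ P.length) :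
    D.ddist (S.vert t) (P.vert (t + δ)) ≤ (3 * δ + κ * (2 * δ) : ℕ) := by
  have hx : P.vert 0 = S.vert 0 := hxy.1.trans hxz.1.symm
  have hz : R.vert R.length = S.vert S.length := hyz.2.trans hxz.2.symm
  have hSR : ∀ j ≤ R.length, D.ddist (R.vert j) (S.vert S.length) ≤ (R.length : ℕ) := by
    intro j hj
    rw [← hz]
    refine (R.ddist_le hj le_rfl).trans ?_
    exact_mod_cast Nat.sub_le _ _
  -- Closeness to `R` would give a shortcut making `S` shorter than `P`.
  obtain ⟨τ, hτ, hτd⟩ : ∃ τ ≤ S.length, D.ddist (S.vert τ) (P.vert (t + δ)) ≤ δ := by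
    rcases h x y z P S R hP hS hR hxy (Or.inl hxz) (Or.inl hyz) (t + δ) (by omega) with
      h1 | ⟨j, hj, hd⟩
    · exact h1
    · have h1 := P.ddist_le (Nat.zero_le (t + δ)) (by omega)
      rw [hx] at h1
      have h2 := hS.le_add le_rfl (ddist_le_add (ddist_le_add h1 hd) (hSR j hj))
      omega
  have htτ : t ≤ τ := by
    have h1 := S.ddist_le (Nat.zero_le τ) hτ
    rw [← hx] at h1
    have h2 := hP.le_add (by omega) (ddist_le_add h1 hτd)
    omega
  -- A vertex of `P` beyond `t + δ` close to `S.vert σ` can reach `P.vert (t + δ)` via `S.vert τ`;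
  -- the return bound then limits how far beyond it lies.
  have hbound : ∀ σ ≤ τ, σ + δ + R.length < S.length →
      σ ≤ t + 2 * δ + κ * (2 * δ + (τ - σ)) := by
    intro σ hσ hσ'
    obtain ⟨π, hπ, hπd⟩ : ∃ π ≤ P.length, D.ddist (P.vert π) (S.vert σ) ≤ δ := by
      rcases h x z y S P R hS hP hR hxz (Or.inl hxy) (Or.inr hyz) σ (by omega) with
        h1 | ⟨j, hj, hd⟩
      · exact h1
      · have h2 := hS.le_add le_rfl (ddist_le_add hd (hSR j hj))
        omega
    have h1 := P.ddist_le (Nat.zero_le π) hπ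
    rw [hx] at h1
    have h2 := hS.le_add (by omega) (ddist_le_add h1 hπd)
    rcases le_total π (t + δ) with h3 | h3
    · omega
    · have h4 := ddist_le_add (ddist_le_add hπd (S.ddist_le hσ hτ)) hτd
      have h5 := hκ _ _ _ (ne_top_of_le_ne_top (ENat.natCast_ne_top _) (P.ddist_le h3 hπ)) h4
      have h6 := hP.le_add hπ h5
      rw [show δ + (τ - σ) + δ = 2 * δ + (τ - σ) by ring] at h6
      omega
  have hτ' : τ + δ + R.length < S.length := by
    by_contra hcon
    -- If `τ` is too near the end of `S`, the last admissible `σ` contradicts `ht`.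
    have h1 := hbound (S.length - δ - R.length - 1) (by omega) (by omega)
    have h2 : κ * (2 * δ + (τ - (S.length - δ - R.length - 1))) ≤ κ * (3 * δ + R.length + 1) :=
      Nat.mul_le_mul_left _ (by omega)
    omega
  have h1 := hbound τ le_rfl hτ'
  rw [Nat.sub_self, Nat.add_zero] at h1
  refine (ddist_le_add (S.ddist_le htτ hτ) hτd).trans ?_
  norm_cast
  omega

/-- The same as `IsThin.ddist_le_of_common_start` for geodesics with a common end. -/
theorem IsThin.ddist_le_of_common_end {δ κ : ℕ} (h : D.IsThin δ) (hκ : D.HasReturnBound κ)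
    {P S R : D.DiPath} (hP : P.IsGeodesic) (hS : S.IsGeodesic) (hR : R.IsGeodesic)
    (hyz : P.IsFromTo y z) (hxz : S.IsFromTo x z) (hxy : R.IsFromTo x y)
    (hle : P.length ≤ S.length) {t : ℕ}
    (ht : t + (3 * δ + R.length + 2 + κ * (3 * δ + R.length + 1)) ≤ P.length) :
    D.ddist (P.vert (P.length - (t + δ))) (S.vert (S.length - t)) ≤
      (3 * δ + κ * (2 * δ) : ℕ) := by
  have := h.reverse.ddist_le_of_common_start hκ.reverse hP.reverse hS.reverse hR.reverse
    (DiPath.reverse_isFromTo.2 hyz) (DiPath.reverse_isFromTo.2 hxz)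
    (DiPath.reverse_isFromTo.2 hxy) hle ht
  rwa [ddist_reverse] at this

/-- Two geodesics whose starts and whose ends are joined by geodesics of length at most `r` run
close to each other, away from their ends. -/
theorem IsThin.ddist_le_of_square {δ κ : ℕ} (h : D.IsThin δ) (hκ : D.HasReturnBound κ)
    {P P' S : D.DiPath} (hP : P.IsGeodesic) (hP' : P'.IsGeodesic) (hS : S.IsGeodesic)
    (hPS : P.first = S.first) (hPS' : P'.last = S.last) {r : ℕ}
    (hstart : D.ddist P.first P'.first ≤ r) (hend : D.ddist P.last P'.last ≤ r)
    (hlen : P'.length = P.length) {s : ℕ} (hs : S.length = P.length + s) {t : ℕ}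
    (ht : 3 * δ + r + 2 + κ * (3 * δ + r + 1) ≤ t)
    (ht' : t + s + δ + (3 * δ + r + 2 + κ * (3 * δ + r + 1)) ≤ P.length) :
    D.ddist (P'.vert t) (P.vert (t + (s + 2 * δ))) ≤ (2 * (3 * δ + κ * (2 * δ)) : ℕ) := by
  obtain ⟨R, hR, hRxy, -, hRl⟩ := exists_isGeodesic_of_le hstart
  obtain ⟨R', hR', hRyz', -, hRl'⟩ := exists_isGeodesic_of_le hend
  have hmono : ∀ l ≤ r, 3 * δ + l + 2 + κ * (3 * δ + l + 1) ≤
      3 * δ + r + 2 + κ * (3 * δ + r + 1) := fun l hl => by gcongr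
  have h1 := hmono _ hRl
  have h2 := hmono _ hRl'
  -- Both comparisons pass through vertex `t + s + δ` of the diagonal `S`.
  have h3 := h.ddist_le_of_common_end hκ hP' hS hR ⟨rfl, rfl⟩ ⟨hPS.symm, hPS'.symm⟩ hRxy
    (by omega) (t := P.length - t - δ) (by omega)
  have h4 := h.ddist_le_of_common_start hκ hP hS hR' ⟨rfl, rfl⟩ ⟨hPS.symm, hPS'.symm⟩ hRyz'
    (by omega) (t := t + s + δ) (by omega)
  rw [show P'.length - (P.length - t - δ + δ) = t by omega,
    show S.length - (P.length - t - δ) = t + s + δ by omega] at h3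
  rw [show t + s + δ + δ = t + (s + 2 * δ) by ring] at h4
  refine (ddist_le_add h3 h4).trans (le_of_eq ?_)
  congr 1
  ring

end Digraph

/-! ### Orbits of edge-preserving maps -/

namespace Digraph

variable {V : Type*} {D : Digraph V} {x y z : V}

/-- The image of a directed path under a map that preserves edges. -/
def DiPath.map {f : V → V} (hf : ∀ x y, D.Adj x y → D.Adj (f x) (f y)) (P : D.DiPath) :
    D.DiPath where
  length := P.length
  vert i := f (P.vert i)
  adj i hi := hf _ _ (P.adj i hi)

theorem ddist_map_le {f : V → V} (hf : ∀ x y, D.Adj x y → D.Adj (f x) (f y)) (x y : V) :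
    D.ddist (f x) (f y) ≤ D.ddist x y := by
  refine le_iInf₂ fun P hP => ddist_le_length (P := P.map hf) ⟨?_, ?_⟩
  · rw [← hP.1]; rfl
  · rw [← hP.2]; rfl

theorem adj_iterate {f : V → V} (hf : ∀ x y, D.Adj x y → D.Adj (f x) (f y)) (k : ℕ) (x y : V)
    (h : D.Adj x y) : D.Adj (f^[k] x) (f^[k] y) := by
  induction k with
  | zero => exact h
  | succ k ih => simpa only [Function.iterate_succ_apply'] using hf _ _ ih

section Orbit

variable {f : V → V} (hf : ∀ x y, D.Adj x y → D.Adj (f x) (f y)) {o : V} {L : ℕ}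
  (hL : D.ddist o (f o) ≤ L)

include hf in
theorem ddist_iterate_le_of_le (n : ℕ) {B B' : ℕ} (h : B ≤ B') :
    D.ddist (f^[B'] o) (f^[B' + n] o) ≤ D.ddist (f^[B] o) (f^[B + n] o) := by
  obtain ⟨k, rfl⟩ := Nat.exists_eq_add_of_le' h
  rw [Function.iterate_add_apply, add_assoc, Function.iterate_add_apply f k]
  exact ddist_map_le (adj_iterate hf k) _ _

include hf hL in
theorem ddist_iterate_le (B n : ℕ) : D.ddist (f^[B] o) (f^[B + n] o) ≤ (L * n : ℕ) := by
  induction n with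
  | zero => simp [ddist_self]
  | succ n ih =>
    have h := (ddist_map_le (adj_iterate hf (B + n)) o (f o)).trans hL
    rw [← Function.iterate_succ_apply] at h
    exact ddist_le_add ih h

include hf hL in
-- The distance is nonincreasing in `B` and finite, so it stabilises at its minimum.
theorem exists_eventually_ddist_iterate (n : ℕ) : ∃ a : ℕ,
    (∀ᶠ B in Filter.atTop, D.ddist (f^[B] o) (f^[B + n] o) = a) ∧
      ∀ B, (a : ℕ∞) ≤ D.ddist (f^[B] o) (f^[B + n] o) := by
  obtain ⟨_, ⟨B, rfl⟩, hB⟩ := (wellFounded_lt (α := ℕ∞)).has_min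
    (Set.range fun B => D.ddist (f^[B] o) (f^[B + n] o)) ⟨_, 0, rfl⟩
  have hmin : ∀ B', D.ddist (f^[B] o) (f^[B + n] o) ≤ D.ddist (f^[B'] o) (f^[B' + n] o) :=
    fun B' => not_lt.1 (hB _ ⟨B', rfl⟩)
  obtain ⟨a, ha⟩ := ENat.ne_top_iff_exists.1
    (ne_top_of_le_ne_top (ENat.natCast_ne_top _) (ddist_iterate_le hf hL B n))
  refine ⟨a, ?_, fun B' => ha ▸ hmin B'⟩
  filter_upwards [Filter.eventually_ge_atTop B] with B' hB'
  rw [ha]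
  exact le_antisymm (ddist_iterate_le_of_le hf n hB') (hmin B')

include hf hL in
/-- The orbit of a vertex under an edge-preserving map of a hyperbolic digraph with bounded balls is
undistorted, if the map has no periodic vertices. -/
theorem IsThin.exists_le_mul_ddist_iterate {δ : ℕ} (h : D.IsThin δ) (hout : D.HasBoundedOutBalls)
    (hin : D.reverse.HasBoundedOutBalls) (hinj : ∀ x, Function.Injective fun i => f^[i] x) :
    ∃ K : ℕ, ∀ m n d : ℕ, D.ddist (f^[m] o) (f^[m + n] o) ≤ d → n ≤ K * d := by
  classical
  obtain ⟨κ, hκ⟩ := h.exists_hasReturnBound hout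
  choose α hα hαle using exists_eventually_ddist_iterate (D := D) hf hL
  have hαL : ∀ n, α n ≤ L * n := fun n => by
    exact_mod_cast (hαle n 0).trans (ddist_iterate_le hf hL 0 n)
  have hadd : ∀ m n, α (m + n) ≤ α m + α n := by
    intro m n
    obtain ⟨B, hB, hB'⟩ := ((hα m).and ((Filter.tendsto_add_atTop_nat m).eventually (hα n))).exists
    have h1 := (hαle (m + n) B).trans
      (by simpa only [add_assoc] using ddist_le_add hB.le hB'.le)
    exact_mod_cast h1
  have hmul : ∀ n q, α (n * q) ≤ q * α n := by
    intro n q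
    induction q with
    | zero => simpa using hαL 0
    | succ q ih =>
      rw [Nat.mul_succ]
      refine (hadd _ _).trans ?_
      rw [Nat.succ_mul]
      omega
  -- Otherwise, for one large `B`, more than `N` distinct orbit points would lie in one out-ball.
  have hproper : ∀ r, ∃ N₀, ∀ n ≥ N₀, r ≤ α n := by
    intro r
    obtain ⟨N, hN⟩ := hout r
    have hfin : {n | α n < r}.Finite := by
      by_contra hcon
      obtain ⟨s, hs, hcard⟩ := Set.Infinite.exists_subset_card_eq hcon (N + 1)
      obtain ⟨B, hB⟩ := ((Filter.eventually_all_finset s).2 fun n _ => hα n).exists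
      have := hN (f^[B] o) (s.image fun n => f^[n] (f^[B] o)) (by
        intro y hy
        obtain ⟨n, hn, rfl⟩ := Finset.mem_image.1 hy
        rw [← Function.iterate_add_apply, add_comm n B, hB n hn]
        have : α n < r := hs hn
        exact_mod_cast this.le)
      rw [Finset.card_image_of_injective _ (hinj _)] at this
      omega
    obtain ⟨b, hb⟩ := hfin.bddAbove
    refine ⟨b + 1, fun n hn => ?_⟩
    by_contra hcon
    have : n ≤ b := hb (Set.mem_ofPred_eq ▸ not_le.1 hcon)
    omega
  set R := 2 * (3 * δ + κ * (2 * δ)) with hR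
  obtain ⟨Nb, hNb⟩ := hin R
  set K := (R + 1) * Nb + 1 with hK
  suffices hsuff : ∀ m, m ≤ K * α m by
    refine ⟨K, fun m n d hd => (hsuff n).trans (Nat.mul_le_mul_left _ ?_)⟩
    exact_mod_cast (hαle n m).trans hd
  intro m
  -- `M` is the margin at each end outside which `P` and its images fellow-travel; `N₀` leaves room
  -- for `m` shifts between the margins.
  set M := 3 * δ + L * K + 2 + κ * (3 * δ + L * K + 1) with hM
  obtain ⟨N₀, hN₀⟩ := hproper (M + m * (L * K + 2 * δ) + L * K + δ + M)
  obtain ⟨_, ⟨N, hN, rfl⟩, hmin⟩ := (wellFounded_lt (α := ℕ)).has_min (α '' Set.Ici N₀)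
    ⟨_, N₀, Set.self_mem_Ici, rfl⟩
  -- This makes the diagonal at least as long as `P`, so the subtraction `α (N + k) - α N` below is
  -- not truncated.
  have hNmin : ∀ k, α N ≤ α (N + k) := fun k =>
    not_lt.1 (hmin _ ⟨N + k, Nat.le_add_right_of_le hN, rfl⟩)
  have hNlarge := hN₀ N hN
  -- From this `B` on, all orbit distances needed have stabilised; in particular images of `P` under
  -- `f^[k]` stay geodesic.
  obtain ⟨B, hB⟩ := Filter.eventually_atTop.1 ((Filter.eventually_all_finset
    (Finset.range (N + K + m * K + 1))).2 fun n _ => hα n)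
  replace hB : ∀ B' ≥ B, ∀ n ≤ N + K + m * K, D.ddist (f^[B'] o) (f^[B' + n] o) = α n :=
    fun B' hB' n hn => hB B' hB' n (Finset.mem_range.2 (by omega))
  obtain ⟨P, hP, hPB, hPl⟩ := exists_isGeodesic (D := D) (x := f^[B] o) (y := f^[B + N] o)
    (by rw [hB B le_rfl N (by omega)]; exact ENat.natCast_ne_top _)
  replace hPl : P.length = α N := by
    rw [hB B le_rfl N (by omega)] at hPl
    exact_mod_cast hPl.symm
  have hshift : ∀ k ≤ K, ∀ t, M ≤ t → t + L * K + δ + M ≤ α N →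
      D.ddist (f^[k] (P.vert t)) (P.vert (t + (α (N + k) - α N + 2 * δ))) ≤ (R : ℕ) := by
    intro k hk t ht ht'
    have hkL : L * k ≤ L * K := Nat.mul_le_mul_left _ hk
    let P' : D.DiPath := P.map (adj_iterate hf k)
    have hP'0 : P'.first = f^[B + k] o := by
      change f^[k] P.first = _
      rw [hPB.1, ← Function.iterate_add_apply, add_comm]
    have hP'1 : P'.last = f^[B + N + k] o := by
      change f^[k] P.last = _
      rw [hPB.2, ← Function.iterate_add_apply, add_comm]
    have hP' : P'.IsGeodesic := by
      rw [DiPath.IsGeodesic, hP'0, hP'1, add_right_comm, hB (B + k) (by omega) N (by omega), ← hPl]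
      rfl
    obtain ⟨S, hS, hSB, hSl⟩ := exists_isGeodesic (D := D) (x := f^[B] o) (y := f^[B + (N + k)] o)
      (by rw [hB B le_rfl _ (by omega)]; exact ENat.natCast_ne_top _)
    rw [hB B le_rfl _ (by omega)] at hSl
    replace hSl : S.length = α (N + k) := by exact_mod_cast hSl.symm
    have h1 := hNmin k
    have h2 := hadd N k
    have h3 := hαL k
    refine h.ddist_le_of_square (P' := P') (S := S) hκ hP hP' hS (hPB.1.trans hSB.1.symm)
      (hP'1.trans (by rw [hSB.2, add_assoc])) (r := L * K) ?_ ?_ rfl (by omega) (by omega)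
      (by omega)
    · rw [hPB.1, hP'0]
      refine (ddist_iterate_le hf hL B k).trans ?_
      exact_mod_cast hkL
    · rw [hPB.2, hP'1]
      refine (ddist_iterate_le hf hL (B + N) k).trans ?_
      exact_mod_cast hkL
  -- Pigeonhole: if all `K` shifts were among the `R + 1` values up to `R`, more than `Nb` of them
  -- would agree, giving too many points in one in-ball.
  obtain ⟨k, hk1, hkK, hkv⟩ : ∃ k, 1 ≤ k ∧ k ≤ K ∧ R + 1 ≤ α (N + k) - α N + 2 * δ := by
    by_contra hcon
    push Not at hcon
    obtain ⟨v, -, hv⟩ := Finset.exists_lt_card_fiber_of_mul_lt_card_of_maps_to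
      (s := Finset.Icc 1 K) (t := Finset.range (R + 1)) (n := Nb)
      (f := fun k => α (N + k) - α N + 2 * δ)
      (fun k hk => Finset.mem_range.2
        (hcon k (Finset.mem_Icc.1 hk).1 (Finset.mem_Icc.1 hk).2))
      (by simp [hK])
    have := hNb (P.vert (M + v)) (({k ∈ Finset.Icc 1 K | α (N + k) - α N + 2 * δ = v}).image
      fun k => f^[k] (P.vert M)) (by
        intro y hy
        obtain ⟨k, hk, rfl⟩ := Finset.mem_image.1 hy
        obtain ⟨hk', rfl⟩ := Finset.mem_filter.1 hk
        rw [ddist_reverse]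
        exact hshift k (Finset.mem_Icc.1 hk').2 M le_rfl (by omega))
    rw [Finset.card_image_of_injective _ (hinj _)] at this
    exact absurd hv this.not_gt
  set v := α (N + k) - α N + 2 * δ with hv
  have hvL : v ≤ L * K + 2 * δ := by
    have h2 := hadd N k
    have h3 := (hαL k).trans (Nat.mul_le_mul_left _ hkK)
    omega
  have hchain : ∀ i ≤ m, D.ddist (f^[k * i] (P.vert M)) (P.vert (M + i * v)) ≤ (R * i : ℕ) := by
    intro i
    induction i with
    | zero => simp [ddist_self]
    | succ i ih =>
      intro hi
      have h1 := (ddist_map_le (adj_iterate hf k) _ _).trans (ih (by omega))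
      rw [← Function.iterate_add_apply] at h1
      have h4 : i * v ≤ m * (L * K + 2 * δ) := Nat.mul_le_mul (by omega) hvL
      have h2 := ddist_le_add h1 (hshift k hkK (M + i * v) (by omega) (by omega))
      rwa [← hv, show k + k * i = k * (i + 1) by ring,
        show M + i * v + v = M + (i + 1) * v by ring] at h2
  have hmk : m * k ≤ m * K := Nat.mul_le_mul_left _ hkK
  have hmv : m * v ≤ m * (L * K + 2 * δ) := Nat.mul_le_mul_left _ hvL
  have h1 := (P.map (adj_iterate hf (k * m))).ddist_le (Nat.zero_le M)
    (show M ≤ P.length by omega)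
  change D.ddist (f^[k * m] P.first) (f^[k * m] (P.vert M)) ≤ _ at h1
  rw [hPB.1, ← Function.iterate_add_apply] at h1
  have h2 := (hB B le_rfl (m * k) (by omega)).le
  rw [show B + m * k = k * m + B by ring, ← hPB.1] at h2
  -- The detour from the start of `P` via its image under `f^[k * m]` to vertex `M + m * v` costs at
  -- most `α (m * k) + M + R * m`; as `v > R`, this leaves `m ≤ α (m * k)`.
  have h3 := hP.le_add (by omega) (ddist_le_add (ddist_le_add h2 h1) (hchain m le_rfl))
  have h4 : m * (R + 1) ≤ m * v := Nat.mul_le_mul_left _ hkv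
  have h5 : m * (R + 1) = R * m + m := by ring
  calc m ≤ α (m * k) := by omega
    _ ≤ k * α m := hmul m k
    _ ≤ K * α m := Nat.mul_le_mul_right _ hkK

end Orbit

end Digraph

/-! ### Cayley digraphs -/

namespace Digraph

variable {M : Type*} [Monoid M] {A A' : Set M} {g : M}

theorem cayley_adj_mul_left (g x y : M) (h : (cayley A).Adj x y) :
    (cayley A).Adj (g * x) (g * y) := by
  obtain ⟨a, ha, rfl⟩ := h
  exact ⟨a, ha, (mul_assoc g x a).symm⟩

theorem ddist_cayley_mul_left_le (g x y : M) :
    (cayley A).ddist (g * x) (g * y) ≤ (cayley A).ddist x y :=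
  ddist_map_le (cayley_adj_mul_left g) x y

/-- Paths spell words: `W` collects products of at most `r` generators, independently of the start.
-/
theorem exists_finset_of_ddist_cayley_le (hA : A.Finite) (r : ℕ) :
    ∃ W : Finset M, ∀ x y, (cayley A).ddist x y ≤ r → ∃ w ∈ W, y = x * w := by
  classical
  suffices h : ∃ W : Finset M, ∀ P : (cayley A).DiPath, P.length ≤ r →
      ∃ w ∈ W, P.last = P.first * w by
    obtain ⟨W, hW⟩ := h
    refine ⟨W, fun x y hxy => ?_⟩
    obtain ⟨P, -, hP, -, hPr⟩ := exists_isGeodesic_of_le hxy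
    simpa only [hP.1, hP.2] using hW P hPr
  induction r with
  | zero =>
    refine ⟨{1}, fun P hP => ⟨1, by simp, ?_⟩⟩
    rw [DiPath.last, Nat.le_zero.1 hP, mul_one, DiPath.first]
  | succ r ih =>
    obtain ⟨W, hW⟩ := ih
    refine ⟨W ∪ Finset.image₂ (· * ·) W hA.toFinset, fun P hP => ?_⟩
    rcases Nat.lt_or_ge r P.length with hr | hr
    · let Q : (cayley A).DiPath := ⟨r, P.vert, fun i hi => P.adj i (by omega)⟩
      obtain ⟨w, hw, hQ⟩ := hW Q le_rfl
      obtain ⟨a, ha, hPa⟩ := P.adj r hr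
      refine ⟨w * a, Finset.mem_union_right _
        (Finset.mem_image₂_of_mem hw (hA.mem_toFinset.2 ha)), ?_⟩
      have hl : P.length = r + 1 := by omega
      rw [DiPath.last, hl, hPa, ← mul_assoc]
      exact congrArg (· * a) hQ
    · obtain ⟨w, hw, h⟩ := hW P hr
      exact ⟨w, Finset.mem_union_left _ hw, h⟩

theorem exists_mul_eq_of_ddist_cayley_ne_top {x y : M} (hA : A.Finite)
    (h : (cayley A).ddist x y ≠ ⊤) : ∃ w, y = x * w := by
  obtain ⟨n, hn⟩ := ENat.ne_top_iff_exists.1 h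
  obtain ⟨W, hW⟩ := exists_finset_of_ddist_cayley_le hA n
  obtain ⟨w, -, hw⟩ := hW x y hn.ge
  exact ⟨w, hw⟩

theorem hasBoundedOutBalls_cayley (hA : A.Finite) : (cayley A).HasBoundedOutBalls := by
  classical
  intro r
  obtain ⟨W, hW⟩ := exists_finset_of_ddist_cayley_le hA r
  refine ⟨W.card, fun x s hs => ?_⟩
  refine (Finset.card_le_card (t := W.image (x * ·)) fun y hy => ?_).trans Finset.card_image_le
  obtain ⟨w, hw, rfl⟩ := hW x y (hs y hy)
  exact Finset.mem_image_of_mem _ hw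

/-- By right cancellation, `x = y * w` determines `y` from `w`. -/
theorem hasBoundedOutBalls_reverse_cayley [IsRightCancelMul M] (hA : A.Finite) :
    (cayley A).reverse.HasBoundedOutBalls := by
  intro r
  obtain ⟨W, hW⟩ := exists_finset_of_ddist_cayley_le hA r
  refine ⟨W.card, fun x s hs => ?_⟩
  have h : ∀ y : M, ∃ w, y ∈ s → w ∈ W ∧ x = y * w := by
    intro y
    by_cases hy : y ∈ s
    · obtain ⟨w, hw⟩ := hW y x (by simpa only [ddist_reverse] using hs y hy)
      exact ⟨w, fun _ => hw⟩
    · exact ⟨1, fun h => absurd h hy⟩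
  choose w hw using h
  refine Finset.card_le_card_of_injOn w (fun y hy => (hw y hy).1) fun y hy z hz hyz => ?_
  have h1 := (hw y hy).2.symm.trans (hw z hz).2
  rw [hyz] at h1
  exact mul_right_cancel h1

theorem ddist_cayley_one_ne_top (hA : Submonoid.closure A = ⊤) (x : M) :
    (cayley A).ddist 1 x ≠ ⊤ := by
  have hx : x ∈ Submonoid.closure A := hA ▸ Submonoid.mem_top x
  induction hx using Submonoid.closure_induction with
  | mem a ha =>
    have h : (cayley A).Adj 1 a := ⟨a, ha, (one_mul a).symm⟩
    exact ne_top_of_le_ne_top (ENat.natCast_ne_top _) h.ddist_le_one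
  | one => simp [ddist_self]
  | mul x y _ _ hx hy =>
    refine ddist_ne_top_trans hx (ne_top_of_le_ne_top hy ?_)
    simpa using ddist_cayley_mul_left_le x 1 y

/-- `K` bounds the `A'`-length of every generator in `A`; left multiplication carries this bound to
every edge. -/
theorem exists_ddist_cayley_le_mul (hA : A.Finite) (hA' : Submonoid.closure A' = ⊤) :
    ∃ K : ℕ, ∀ x y (n : ℕ), (cayley A).ddist x y ≤ n → (cayley A').ddist x y ≤ (K * n : ℕ) := by
  obtain ⟨K, hK⟩ : ∃ K : ℕ, ∀ a ∈ A, (cayley A').ddist 1 a ≤ K := by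
    obtain ⟨K, hK⟩ := (hA.image fun a => ((cayley A').ddist 1 a).toNat).bddAbove
    refine ⟨K, fun a ha => ?_⟩
    rw [← ENat.natCast_toNat (ddist_cayley_one_ne_top hA' a)]
    exact_mod_cast hK ⟨a, ha, rfl⟩
  refine ⟨K, fun x y n hxy => ?_⟩
  obtain ⟨P, -, hP, -, hPn⟩ := exists_isGeodesic_of_le hxy
  have h : ∀ i ≤ P.length, (cayley A').ddist (P.vert 0) (P.vert i) ≤ (K * i : ℕ) := by
    intro i
    induction i with
    | zero => simp [ddist_self]
    | succ i ih =>
      intro hi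
      obtain ⟨a, ha, hPa⟩ := P.adj i hi
      have h1 := (ddist_cayley_mul_left_le (P.vert i) 1 a).trans (hK a ha)
      rw [mul_one, ← hPa] at h1
      exact ddist_le_add (ih (by omega)) h1
  have h1 := h P.length le_rfl
  rw [show P.vert 0 = x from hP.1, show P.vert P.length = y from hP.2] at h1
  refine h1.trans ?_
  exact_mod_cast Nat.mul_le_mul_left _ hPn

section Powers

theorem DiPath.powersCayley_vert (P : (powersCayley g).DiPath) {i : ℕ} (hi : i ≤ P.length) :
    (P.vert i : M) = P.vert 0 * g ^ i := by
  induction i with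
  | zero => simp
  | succ i ih =>
    obtain ⟨a, rfl, ha⟩ := P.adj i hi
    rw [ha, Submonoid.coe_mul, ih (by omega), pow_succ, mul_assoc]

variable {u v : Submonoid.powers g} {m n : ℕ}

theorem eq_add_of_powersCayley_isFromTo (hg : Function.Injective fun n : ℕ => g ^ n)
    (hu : (u : M) = g ^ m) (hv : (v : M) = g ^ n) {P : (powersCayley g).DiPath}
    (hP : P.IsFromTo u v) : n = m + P.length := by
  apply hg
  have h := P.powersCayley_vert le_rfl
  rw [show P.vert P.length = v from hP.2, show P.vert 0 = u from hP.1, hu, hv, ← pow_add] at h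
  exact h

theorem ddist_powersCayley_of_le (hg : Function.Injective fun n : ℕ => g ^ n)
    (hu : (u : M) = g ^ m) (hv : (v : M) = g ^ (m + n)) : (powersCayley g).ddist u v = n := by
  refine le_antisymm ?_ (le_iInf₂ fun P hP => ?_)
  · let P : (powersCayley g).DiPath :=
      ⟨n, fun i => ⟨g ^ (m + i), m + i, rfl⟩, fun i _ =>
        ⟨_, rfl, Subtype.ext (pow_succ g (m + i))⟩⟩
    exact ddist_le_length (P := P) ⟨Subtype.ext hu.symm, Subtype.ext hv.symm⟩
  · rw [Nat.add_left_cancel (eq_add_of_powersCayley_isFromTo hg hu hv hP)]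

theorem ddist_powersCayley_of_lt (hg : Function.Injective fun n : ℕ => g ^ n)
    (hu : (u : M) = g ^ m) (hv : (v : M) = g ^ n) (h : n < m) : (powersCayley g).ddist u v = ⊤ :=
  iInf₂_eq_top.2 fun P hP => by
    have := eq_add_of_powersCayley_isFromTo hg hu hv hP
    omega

end Powers

/-! ### Powers of `g` -/

theorem qiBounds_of_le_mul {G : ℕ} {a b : ℕ∞} (h₁ : a ≤ G * b) (h₂ : b ≤ G * a) :
    QIBounds G 0 a b := by
  have h₁' := ENat.toENNReal_le.2 h₁
  have h₂' := ENat.toENNReal_le.2 h₂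
  rw [ENat.toENNReal_mul, ENat.toENNReal_coe] at h₁' h₂'
  refine ⟨?_, by simpa using h₂'⟩
  refine tsub_le_self.trans (ENNReal.div_le_of_le_mul' (by simpa using h₁'))

theorem pow_injective_of_not_isOfFinOrder [IsRightCancelMul M] (hg : ¬ IsOfFinOrder g) :
    Function.Injective fun n : ℕ => g ^ n := by
  have key : ∀ m n : ℕ, m < n → g ^ m ≠ g ^ n := by
    intro m n hmn h
    refine hg (isOfFinOrder_iff_pow_eq_one.2 ⟨n - m, Nat.sub_pos_of_lt hmn, ?_⟩)
    refine mul_right_cancel (b := g ^ m) ?_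
    rw [← pow_add, Nat.sub_add_cancel hmn.le, one_mul, h]
  intro m n h
  by_contra hne
  rcases lt_or_gt_of_ne hne with hlt | hlt
  · exact key m n hlt h
  · exact key n m hlt h.symm

theorem iterate_mul_left_injective [IsRightCancelMul M] (hg : ¬ IsOfFinOrder g) (x : M) :
    Function.Injective fun n : ℕ => (fun y => g * y)^[n] x := by
  intro m n h
  simp only [mul_left_iterate] at h
  exact pow_injective_of_not_isOfFinOrder hg (mul_right_cancel h)

theorem not_isElliptic_mul_left [IsRightCancelMul M] (hg : ¬ IsOfFinOrder g) :
    ¬ IsElliptic fun x => g * x := by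
  rintro ⟨F, hF, ⟨x, hx⟩, hfix⟩
  have hmem : ∀ n : ℕ, (fun y => g * y)^[n] x ∈ F := by
    intro n
    induction n with
    | zero => exact hx
    | succ n ih =>
      rw [Function.iterate_succ_apply', ← hfix]
      exact Set.mem_image_of_mem _ ih
  exact Set.infinite_of_injective_forall_mem (iterate_mul_left_injective hg x) hmem hF

theorem isSelfEmbedding_mul_left [IsLeftCancelMul M] (g : M) :
    (cayley A).IsSelfEmbedding fun x => g * x := by
  refine ⟨fun x y h => mul_left_cancel h, fun x y => ⟨?_, cayley_adj_mul_left g x y⟩⟩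
  rintro ⟨a, ha, h⟩
  exact ⟨a, ha, mul_left_cancel (h.trans (mul_assoc g x a))⟩

/-- Cancelling `g ^ m` gives a right inverse of `g`; cancelling `g` once more makes it two-sided. -/
theorem isUnit_of_pow_mul_eq_pow [IsLeftCancelMul M] {m n : ℕ} {x : M} (hmn : m < n)
    (h : g ^ n * x = g ^ m) : IsUnit g := by
  obtain ⟨k, rfl⟩ := Nat.exists_eq_add_of_lt hmn
  have h1 : g * (g ^ k * x) = 1 := by
    refine mul_left_cancel (a := g ^ m) ?_
    rw [mul_one, ← mul_assoc g, ← pow_succ', ← mul_assoc, ← pow_add, ← add_assoc, h]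
  have h2 : g ^ k * x * g = 1 := by
    refine mul_left_cancel (a := g) ?_
    rw [← mul_assoc, h1, one_mul, mul_one]
  exact ⟨⟨g, g ^ k * x, h1, h2⟩, rfl⟩

theorem _root_.IsHyperbolicMonoid.exists_bounds_pow [IsRightCancelMul M]
    (hM : IsHyperbolicMonoid M) (hg : ¬ IsOfFinOrder g) (hA : IsFiniteGeneratingSet A) :
    ∃ G : ℕ, 1 ≤ G ∧ (∀ m n : ℕ, (n : ℕ∞) ≤ G * (cayley A).ddist (g ^ m) (g ^ (m + n)) ∧
        (cayley A).ddist (g ^ m) (g ^ (m + n)) ≤ G * (n : ℕ∞)) ∧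
      ∀ m n : ℕ, (cayley A).ddist (g ^ (m + n)) (g ^ m) ≠ ⊤ →
        (n : ℕ∞) ≤ G * (cayley A).ddist (g ^ (m + n)) (g ^ m) ∧
        (cayley A).ddist (g ^ (m + n)) (g ^ m) ≤ G * (n : ℕ∞) := by
  obtain ⟨A', hA', δ, hδ⟩ := hM
  have hthin := hδ.isThin
  have hout := hasBoundedOutBalls_cayley hA'.1
  obtain ⟨κ, hκ⟩ := hthin.exists_hasReturnBound hout
  obtain ⟨L, hL⟩ := ENat.ne_top_iff_exists.1 (ddist_cayley_one_ne_top hA'.2 g)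
  have hL' : (cayley A').ddist 1 (g * 1) ≤ L := by rw [mul_one, hL]
  obtain ⟨E, hE⟩ := hthin.exists_le_mul_ddist_iterate (cayley_adj_mul_left g) hL' hout
    (hasBoundedOutBalls_reverse_cayley hA'.1) (iterate_mul_left_injective hg)
  obtain ⟨K, hK⟩ := exists_ddist_cayley_le_mul hA'.1 hA.2
  obtain ⟨K', hK'⟩ := exists_ddist_cayley_le_mul hA.1 hA'.2
  have hup : ∀ m n : ℕ, (cayley A').ddist (g ^ m) (g ^ (m + n)) ≤ (L * n : ℕ) := fun m n => by
    simpa using ddist_iterate_le (cayley_adj_mul_left g) hL' m n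
  simp only [mul_left_iterate, mul_one] at hE
  have hlow : ∀ m n d : ℕ, (cayley A).ddist (g ^ m) (g ^ (m + n)) ≤ d → n ≤ E * (K' * d) :=
    fun m n d hd => hE m n _ (hK' _ _ d hd)
  -- The four products are the constants for the forward and backward lower and upper bounds; their
  -- sum serves all four.
  refine ⟨1 + E * K' + K * L + E * κ * K' + K * κ * L, by omega, fun m n => ?_, fun m n hne => ?_⟩
  · have h1 := hK _ _ _ (hup m n)
    obtain ⟨d, hd⟩ := ENat.ne_top_iff_exists.1 (ne_top_of_le_ne_top (ENat.natCast_ne_top _) h1)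
    have h2 := hlow m n d hd.ge
    rw [← hd] at h1 ⊢
    norm_cast at h1 ⊢
    constructor <;> nlinarith [Nat.zero_le (E * κ * K' * d), Nat.zero_le (K * κ * L * d),
      Nat.zero_le (K * L * d), Nat.zero_le (E * K' * n), Nat.zero_le (E * κ * K' * n),
      Nat.zero_le (K * κ * L * n)]
  · obtain ⟨d, hd⟩ := ENat.ne_top_iff_exists.1 hne
    have h1 := hK' _ _ _ hd.ge
    have h2 := hE m n _ (hκ _ _ _
      (ne_top_of_le_ne_top (ENat.natCast_ne_top _) (hup m n)) h1)
    have h3 := hK _ _ _ (hκ _ _ _ (ne_top_of_le_ne_top (ENat.natCast_ne_top _) h1) (hup m n))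
    rw [← hd] at h3 ⊢
    norm_cast at h3 ⊢
    constructor <;> nlinarith [Nat.zero_le (E * K' * d), Nat.zero_le (K * κ * L * d),
      Nat.zero_le (K * L * d), Nat.zero_le (E * K' * n), Nat.zero_le (E * κ * K' * n),
      Nat.zero_le (K * L * n)]

end Digraph

theorem mainTheorem5 {M : Type*} [Monoid M] [IsRightCancelMul M] (hM : IsHyperbolicMonoid M)
    (g : M) (hg : ¬ IsOfFinOrder g) (A : Set M) (hA : IsFiniteGeneratingSet A) :
    -- left multiplication by `g` on the Cayley digraph
    (∀ x y, (Digraph.cayley A).Adj x y → (Digraph.cayley A).Adj (g * x) (g * y)) ∧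
    (IsLeftCancelMul M → (Digraph.cayley A).IsSelfEmbedding (fun x => g * x)) ∧
    ¬ Digraph.IsElliptic (fun x => g * x) ∧
    -- the embedding of `⟨g⟩` into `M`
    ∃ γ c : ℝ≥0, 1 ≤ γ ∧
      (∀ u v : Submonoid.powers g, (powersCayley g).ddist u v ≠ ⊤ →
        Digraph.QIBounds γ c ((powersCayley g).ddist u v)
          ((Digraph.cayley A).ddist (u : M) (v : M))) ∧
      (∀ u v : Submonoid.powers g, (powersCayley g).ddist u v = ⊤ →
        (Digraph.cayley A).ddist (u : M) (v : M) = ⊤ ∨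
        Digraph.QIBounds γ c ((powersCayley g).ddist v u)
          ((Digraph.cayley A).ddist (u : M) (v : M))) ∧
      ((∀ (m n : ℕ) (x : M), m < n → g ^ n * x ≠ g ^ m) →
        Digraph.IsQIEmbedding γ c (powersCayley g) (Digraph.cayley A)
          (fun u : Submonoid.powers g => (u : M))) ∧
      (IsLeftCancelMul M → ¬ IsUnit g →
        Digraph.IsQIEmbedding γ c (powersCayley g) (Digraph.cayley A)
          (fun u : Submonoid.powers g => (u : M))) := by
  have hinj := Digraph.pow_injective_of_not_isOfFinOrder hg
  obtain ⟨G, hG, hfor, hback⟩ := hM.exists_bounds_pow hg hA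
  have hQI : (∀ (m n : ℕ) (x : M), m < n → g ^ n * x ≠ g ^ m) →
      Digraph.IsQIEmbedding G 0 (powersCayley g) (Digraph.cayley A)
        (fun u : Submonoid.powers g => (u : M)) := by
    refine fun hne => ⟨by exact_mod_cast hG, ?_⟩
    rintro ⟨_, m, rfl⟩ ⟨_, n, rfl⟩
    rcases le_or_gt m n with hmn | hmn
    · obtain ⟨k, rfl⟩ := Nat.exists_eq_add_of_le hmn
      rw [Digraph.ddist_powersCayley_of_le hinj (m := m) (n := k) rfl rfl]
      exact Digraph.qiBounds_of_le_mul (hfor m k).1 (hfor m k).2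
    -- Against the direction of `g` both distances are infinite; `G ≠ 0` is then needed for `G * ⊤ =
    -- ⊤`.
    · have htop : (Digraph.cayley A).ddist (g ^ m) (g ^ n) = ⊤ := by
        by_contra hcon
        obtain ⟨x, hx⟩ := Digraph.exists_mul_eq_of_ddist_cayley_ne_top hA.1 hcon
        exact hne n m x hmn hx.symm
      rw [Digraph.ddist_powersCayley_of_lt hinj (m := m) (n := n) rfl rfl hmn]
      refine Digraph.qiBounds_of_le_mul ?_ ?_
      · change _ ≤ _ * (Digraph.cayley A).ddist (g ^ m) (g ^ n)
        rw [htop, ENat.mul_top (by exact_mod_cast (by omega : G ≠ 0))]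
      · rw [ENat.mul_top (by exact_mod_cast (by omega : G ≠ 0))]
        exact le_top
  refine ⟨Digraph.cayley_adj_mul_left g, fun _ => Digraph.isSelfEmbedding_mul_left g,
    Digraph.not_isElliptic_mul_left hg, G, 0, by exact_mod_cast hG, ?_, ?_, hQI,
    fun _ hunit => hQI fun m n x hmn h => hunit (Digraph.isUnit_of_pow_mul_eq_pow hmn h)⟩
  · rintro ⟨_, m, rfl⟩ ⟨_, n, rfl⟩ hne
    rcases le_or_gt m n with hmn | hmn
    · obtain ⟨k, rfl⟩ := Nat.exists_eq_add_of_le hmn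
      rw [Digraph.ddist_powersCayley_of_le hinj (m := m) (n := k) rfl rfl]
      exact Digraph.qiBounds_of_le_mul (hfor m k).1 (hfor m k).2
    · exact absurd (Digraph.ddist_powersCayley_of_lt hinj rfl rfl hmn) hne
  · rintro ⟨_, m, rfl⟩ ⟨_, n, rfl⟩ htop
    rcases le_or_gt m n with hmn | hmn
    · obtain ⟨k, rfl⟩ := Nat.exists_eq_add_of_le hmn
      rw [Digraph.ddist_powersCayley_of_le hinj (m := m) (n := k) rfl rfl] at htop
      exact absurd htop (ENat.natCast_ne_top k)
    · obtain ⟨k, rfl⟩ := Nat.exists_eq_add_of_le hmn.le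
      refine or_iff_not_imp_left.2 fun hne => ?_
      rw [Digraph.ddist_powersCayley_of_le hinj (m := n) (n := k) rfl rfl]
      exact Digraph.qiBounds_of_le_mul (hback n k hne).1 (hback n k hne).2
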